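/- Let $n\ge 2$ and let $\lambda,\mu\in\mathbb R$ satisfy $\mu>0$ and $\lambda+2\mu>0$. Let $\Delta^*u=\mu\Delta u+(\lambda+\mu)\nabla\operatorname{div}u$ be the Lamé operator on vector fields $u:\mathbb R^n\to\mathbb C^n$, so that $-\Delta^*$ is the Fourier multiplier with the positive semidefinite matrix symbol $L(\xi)=\mu|\xi|^2I_n+(\lambda+\mu)\xi\xi^t$. With $\widehat f(\xi)=\int_{\mathbb R^n}e^{-ix\cdot\xi}f(x)\,dx$, let $e^{it\sqrt{-\Delta^*}}$ be the Fourier multiplier with symbol $e^{it\sqrt{L(\xi)}}$, that is, $$e^{it\sqrt{-\Delta^*}}f(x)=(2\pi)^{-n}\int_{\mathbb R^n}e^{ix\cdot\xi}\,e^{it\sqrt{L(\xi)}}\,\widehat f(\xi)\,d\xi .$$ Write $\|f\|_{L^1}=\sum_{j=1}^n\|f_j\|_{L^1(\mathbb R^n)}$ and $\|f\|_{L^\infty}=\max_{1\le j\le n}\|f_j\|_{L^\infty(\mathbb R^n)}$. Then there is a constant $C>0$, depending only on $n,\lambda,\mu$, such that for every $f\in L^1(\mathbb R^n;\mathbb C^n)$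 whose Fourier transform $\widehat f$ is supported in the annulus $\{\xi\in\mathbb R^n:1/2\le|\xi|\le2\}$ and every $t\in\mathbb R\setminus\{0\}$, the integral above converges absolutely for every $x\in\mathbb R^n$ and $$\|e^{it\sqrt{-\Delta^*}}f\|_{L^\infty}\le C\,|t|^{-\frac{n-1}2}\,\|f\|_{L^1}.$$ -/

import Mathlib

open MeasureTheory
open scoped ENNReal FourierTransform SchwartzMap LineDeriv Laplacian MatrixOrder ComplexOrder Matrix

noncomputable section

/-- Vector fields `ℝⁿ → ℂⁿ`; the domain carries the Euclidean norm. -/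
abbrev VectorField (n : ℕ) : Type := EuclideanSpace ℝ (Fin n) → Fin n → ℂ

/-- The `L^r` norm of a vector field: the `ℓ^r` sum of the `L^r` norms of its components
for `r < ∞`, and the maximum of the `L^∞` norms of its components for `r = ∞`. -/
def vectorLpNorm {n : ℕ} (f : VectorField n) (r : ℝ≥0∞) : ℝ≥0∞ :=
  if r = ∞ then ⨆ j : Fin n, eLpNorm (fun x => f x j) ∞ volume
  else (∑ j : Fin n, eLpNorm (fun x => f x j) r volume ^ r.toReal) ^ (1 / r.toReal)

/-- The Fourier transform of a vector field, componentwise, in the angular-frequency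
convention `f̂(ξ) = ∫ e^{-i x·ξ} f(x) dx` (so that `-i∇` has the symbol `ξ`). -/
def angularFourier {n : ℕ} (f : VectorField n) : VectorField n := fun ξ j =>
  ∫ x : EuclideanSpace ℝ (Fin n), Complex.exp (-Complex.I * (inner ℝ x ξ : ℝ)) * f x j

/-- The inverse transform `g^∨(x) = (2π)^{-n} ∫ e^{i x·ξ} g(ξ) dξ`, componentwise. -/
def angularFourierInv {n : ℕ} (g : VectorField n) : VectorField n := fun x j =>
  ((2 * Real.pi : ℝ) : ℂ)⁻¹ ^ n *
    ∫ ξ : EuclideanSpace ℝ (Fin n), Complex.exp (Complex.I * (inner ℝ x ξ : ℝ)) * g ξ j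

/-- The Fourier multiplier operator `m(D) f = (m f̂)^∨` with matrix-valued symbol `m`. -/
def matrixMultiplier {n : ℕ} (m : EuclideanSpace ℝ (Fin n) → Matrix (Fin n) (Fin n) ℂ)
    (f : VectorField n) : VectorField n :=
  angularFourierInv fun ξ => (m ξ).mulVec (angularFourier f ξ)

/-- The divergence `∑ₖ ∂ₖ uₖ`. -/
def divergence {n : ℕ} (u : VectorField n) (x : EuclideanSpace ℝ (Fin n)) : ℂ :=
  ∑ k : Fin n, fderiv ℝ (fun y => u y k) x (EuclideanSpace.single k 1)

/-- The Lamé operator `Δ* u = μ Δ u + (λ + μ) ∇ div u`, with `Δ` acting componentwise. -/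
def lameOperator {n : ℕ} (lam mu : ℝ) (u : VectorField n) : VectorField n := fun x j =>
  (mu : ℂ) * (Δ (fun y => u y j)) x +
    ((lam + mu : ℝ) : ℂ) * fderiv ℝ (divergence u) x (EuclideanSpace.single j 1)

/-- The symbol `L(ξ) = μ |ξ|² Iₙ + (λ + μ) ξ ξᵗ` of `-Δ*`. -/
def lameSymbol {n : ℕ} (lam mu : ℝ) (ξ : EuclideanSpace ℝ (Fin n)) :
    Matrix (Fin n) (Fin n) ℂ :=
  ((mu * ‖ξ‖ ^ 2 : ℝ) : ℂ) • (1 : Matrix (Fin n) (Fin n) ℂ) +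
    ((lam + mu : ℝ) : ℂ) • Matrix.of fun j k => ((ξ j * ξ k : ℝ) : ℂ)

/-- The symbol `e^{it√L(ξ)}`: the matrix exponential of `it` times the positive semidefinite
square root of `L(ξ)`. -/
def halfWaveSymbol {n : ℕ} (lam mu t : ℝ) (ξ : EuclideanSpace ℝ (Fin n)) :
    Matrix (Fin n) (Fin n) ℂ :=
  NormedSpace.exp ((Complex.I * (t : ℂ)) • CFC.sqrt (lameSymbol lam mu ξ))

/-- The elastic half-wave propagator `e^{it√(-Δ*)} = e^{it√L(D)}`. -/
def elasticHalfWave {n : ℕ} (lam mu t : ℝ) (f : VectorField n) : VectorField n :=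
  matrixMultiplier (halfWaveSymbol lam mu t) f

theorem angular_eq_fourier {n : ℕ} (h : EuclideanSpace ℝ (Fin n) → ℂ)
    (ξ : EuclideanSpace ℝ (Fin n)) :
    ∫ x, Complex.exp (-Complex.I * (inner ℝ x ξ : ℝ)) * h x
      = 𝓕 h ((2 * Real.pi)⁻¹ • ξ) := by
  rw [Real.fourier_eq']
  refine integral_congr_ae (Filter.Eventually.of_forall fun x => ?_)
  have hpi : (Real.pi : ℂ) ≠ 0 := by exact_mod_cast Real.pi_ne_zero
  simp only [inner_smul_right, smul_eq_mul]
  congr 2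
  push_cast
  field_simp

theorem fourier_partial {n : ℕ} (h : 𝓢(EuclideanSpace ℝ (Fin n), ℂ))
    (ξ : EuclideanSpace ℝ (Fin n)) (j : Fin n) :
    𝓕 (∂_{(EuclideanSpace.single j (1 : ℝ) : EuclideanSpace ℝ (Fin n))} h)
        ((2 * Real.pi)⁻¹ • ξ)
      = Complex.I * (ξ j : ℂ) * 𝓕 h ((2 * Real.pi)⁻¹ • ξ) := by
  have hpi : (Real.pi : ℂ) ≠ 0 := by exact_mod_cast Real.pi_ne_zero
  rw [SchwartzMap.fourier_lineDerivOp_eq]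
  rw [smul_apply, SchwartzMap.smulLeftCLM_apply_apply (by fun_prop)]
  simp [inner_smul_left, EuclideanSpace.inner_single_right]
  field_simp

/-- `L` is the Fourier multiplier of `-Δ*`: `(-Δ* u)^(ξ) = L(ξ) û(ξ)` for Schwartz fields. -/
theorem angularFourier_neg_lameOperator {n : ℕ} (lam mu : ℝ)
    (u : 𝓢(EuclideanSpace ℝ (Fin n), Fin n → ℂ)) (ξ : EuclideanSpace ℝ (Fin n)) :
    angularFourier (fun x => -lameOperator lam mu u x) ξ
      = (lameSymbol lam mu ξ).mulVec (angularFourier u ξ) := by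
  let v : Fin n → 𝓢(EuclideanSpace ℝ (Fin n), ℂ) := fun j =>
    u.postcompCLM (ContinuousLinearMap.proj (R := ℂ) (φ := fun _ : Fin n => ℂ) j)
  let e : Fin n → EuclideanSpace ℝ (Fin n) := fun j => EuclideanSpace.single j 1
  have hv : ∀ j, (v j : EuclideanSpace ℝ (Fin n) → ℂ) = fun y => u y j := fun j => rfl
  have hdiv : divergence (u : VectorField n)
      = ((∑ k, ∂_{e k} (v k) : 𝓢(EuclideanSpace ℝ (Fin n), ℂ)) :
          EuclideanSpace ℝ (Fin n) → ℂ) := by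
    funext x
    simp only [divergence, sum_apply, SchwartzMap.lineDerivOp_apply_eq_fderiv, hv, e]
  have hlap : ∀ j x, (Δ (fun y => u y j)) x = (∑ k, ∂_{e k} (∂_{e k} (v j))) x := by
    intro j x
    rw [← hv, ← SchwartzMap.laplacian_apply,
      SchwartzMap.laplacian_eq_sum (EuclideanSpace.basisFun (Fin n) ℝ)]
    simp [e]
  let w : Fin n → 𝓢(EuclideanSpace ℝ (Fin n), ℂ) := fun j =>
    -((mu : ℂ) • (∑ k, ∂_{e k} (∂_{e k} (v j))) +
      ((lam + mu : ℝ) : ℂ) • ∂_{e j} (∑ k, ∂_{e k} (v k)))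
  have hw : ∀ j x, -lameOperator lam mu u x j = w j x := by
    intro j x
    simp only [lameOperator, hdiv, hlap, w, neg_apply, add_apply,
      smul_apply, SchwartzMap.lineDerivOp_apply_eq_fderiv (e j), smul_eq_mul, e]
  have hnorm : ((‖ξ‖ ^ 2 : ℝ) : ℂ) = ∑ k, (ξ k : ℂ) * (ξ k : ℂ) := by
    rw [EuclideanSpace.real_norm_sq_eq]
    push_cast
    simp [sq]
  funext j
  have hL : angularFourier (fun x => -lameOperator lam mu u x) ξ j
      = 𝓕 (w j) ((2 * Real.pi)⁻¹ • ξ) := by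
    rw [SchwartzMap.fourier_coe, ← angular_eq_fourier]
    simp only [angularFourier, Pi.neg_apply, hw]
  have hR : ∀ k, angularFourier u ξ k = 𝓕 (v k) ((2 * Real.pi)⁻¹ • ξ) := by
    intro k
    rw [SchwartzMap.fourier_coe, ← angular_eq_fourier]
    simp only [angularFourier, hv]
  have hsum : ∀ g : Fin n → 𝓢(EuclideanSpace ℝ (Fin n), ℂ),
      𝓕 (∑ k, g k) = ∑ k, 𝓕 (g k) := fun g =>
    map_sum (FourierTransform.fourierCLM ℂ 𝓢(EuclideanSpace ℝ (Fin n), ℂ)) g Finset.univ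
  rw [hL]
  simp only [w, FourierTransform.fourier_neg, FourierTransform.fourier_add,
    FourierTransform.fourier_smul, hsum, neg_apply, add_apply,
    smul_apply, sum_apply, fourier_partial, e, smul_eq_mul]
  simp only [lameSymbol, Matrix.add_mulVec, Matrix.smul_mulVec, Matrix.one_mulVec, Pi.add_apply,
    Pi.smul_apply, smul_eq_mul, hR]
  simp only [Matrix.mulVec, dotProduct, Matrix.of_apply, hR]
  rw [Complex.ofReal_mul, hnorm]
  simp only [Finset.mul_sum, Finset.sum_mul, ← Finset.sum_add_distrib, ← Finset.sum_neg_distrib]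
  refine Finset.sum_congr rfl fun k _ => ?_
  push_cast
  linear_combination (-(mu : ℂ) * ξ k * ξ k * 𝓕 (v j) ((2 * Real.pi)⁻¹ • ξ)
    - (lam + mu) * ξ j * ξ k * 𝓕 (v k) ((2 * Real.pi)⁻¹ • ξ)) * Complex.I_sq

/-- Under the ellipticity condition `L(ξ)` is positive semidefinite, so its square root is the
genuine one. -/
theorem lameSymbol_nonneg {n : ℕ} {lam mu : ℝ} (hmu : 0 < mu) (hlam : 0 < lam + 2 * mu)
    (ξ : EuclideanSpace ℝ (Fin n)) : 0 ≤ lameSymbol lam mu ξ := by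
  rw [Matrix.nonneg_iff_posSemidef]
  let a : Fin n → ℂ := fun j => (ξ j : ℂ)
  let P : Matrix (Fin n) (Fin n) ℂ := Matrix.vecMulVec a (star a)
  let s : ℝ := ‖ξ‖ ^ 2
  let Q : Matrix (Fin n) (Fin n) ℂ := (s : ℂ) • 1 - P
  have hs : (s : ℂ) = star a ⬝ᵥ a := by
    simp only [s, EuclideanSpace.real_norm_sq_eq, dotProduct, a, Pi.star_apply]
    push_cast
    simp [sq]
  have hP : P.PosSemidef := Matrix.posSemidef_vecMulVec_self_star a
  have hPP : P * P = (s : ℂ) • P := by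
    simp only [P, Matrix.vecMulVec_mul_vecMulVec, hs, Matrix.vecMulVec_smul]
  have hQQ : Q * Q = (s : ℂ) • Q := by
    simp only [Q, mul_sub, sub_mul, hPP, smul_sub, Matrix.mul_smul, Matrix.smul_mul, mul_one,
      one_mul]
    abel
  have hQH : Q.conjTranspose = Q := by
    simp [Q, Matrix.conjTranspose_sub, Matrix.conjTranspose_smul, hP.1.eq]
  have hQ : Q.PosSemidef := by
    rcases (sq_nonneg ‖ξ‖).eq_or_lt with h0 | h0
    · have hξ : ξ = 0 := by simpa using h0.symm
      have : Q = 0 := by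
        ext i j
        simp [Q, P, s, a, hξ, Matrix.vecMulVec_apply]
      rw [this]
      exact Matrix.PosSemidef.zero
    · have h1 : Q = ((s⁻¹ : ℝ) : ℂ) • (Q.conjTranspose * Q) := by
        have : (s : ℂ) ≠ 0 := by exact_mod_cast h0.ne'
        rw [hQH, hQQ, smul_smul]
        push_cast
        rw [inv_mul_cancel₀ this, one_smul]
      rw [h1]
      refine (Matrix.posSemidef_conjTranspose_mul_self Q).smul ?_
      exact_mod_cast (inv_pos.mpr h0).le
  have hdec : lameSymbol lam mu ξ = (mu : ℂ) • Q + ((lam + 2 * mu : ℝ) : ℂ) • P := by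
    ext i j
    simp [lameSymbol, Q, P, s, a, Matrix.vecMulVec_apply]
    ring
  rw [hdec]
  refine (hQ.smul ?_).add (hP.smul ?_)
  · exact_mod_cast hmu.le
  · exact_mod_cast hlam.le

end

/-! With `P` the projection onto the line of `ξ`, the symbol is `e^{it√μ|ξ|}(1 - P) +
e^{it√(λ+2μ)|ξ|}P`: two scalar half-waves with different speeds. On the annulus the factor `|ξ|⁻²`
in `P` may be replaced by a cutoff `Ψ(|ξ|)`, so every entry is a sum of terms `e^{is|ξ|} Ψ(|ξ|)
⟨v,ξ⟩⟨w,ξ⟩`. It remains to bound their inverse Fourier transforms by `C|s|^{-(n-1)/2}` uniformly in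
`x` (`exists_norm_integral_kernelIntegrand_le`); Fubini then gives the `L¹ → L^∞` bound.

For the kernel, rotate so that `x` lies on the first axis and write `ξ = (a, y)` with `y ∈ ℝⁿ⁻¹`.
The factor `e^{ix·ξ}` depends on `a` alone, so it disappears once the slice integral over `y` is
bounded in modulus. All the decay comes from the slice, whose phase `s√(a²+|y|²)` is radial in `y`
with critical point `y = 0`. Polar coordinates leave integrals in `r` with weight `r^k`, which are
`O(|s|^{-(k+1)/2})` uniformly in `a` by elementary integration by parts
(`exists_norm_radialIntegral_le`). Here `k ≥ n - 2`, and only `|a| ≤ 4` contributes. -/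

noncomputable section

/-! ### Radial cutoffs -/

/-- Smooth real functions supported in `[1/4, 4]`. -/
structure IsAnnularCutoff (Θ : ℝ → ℝ) : Prop where
  contDiff : ContDiff ℝ (⊤ : ℕ∞) Θ
  eq_zero : ∀ u, u ∉ Set.Icc (1 / 4 : ℝ) 4 → Θ u = 0

namespace IsAnnularCutoff

variable {Θ : ℝ → ℝ}

theorem continuous (h : IsAnnularCutoff Θ) : Continuous Θ := h.contDiff.continuous

/-- Together with `deriv`, this stability lets the integration by parts be iterated inside one class
of amplitudes. -/
theorem mul_left (h : IsAnnularCutoff Θ) {p : ℝ → ℝ} (hp : ContDiff ℝ (⊤ : ℕ∞) p) :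
    IsAnnularCutoff fun u => p u * Θ u :=
  ⟨hp.mul h.contDiff, fun u hu => by simp [h.eq_zero u hu]⟩

theorem deriv (h : IsAnnularCutoff Θ) : IsAnnularCutoff (deriv Θ) := by
  refine ⟨((contDiff_infty_iff_deriv (𝕜 := ℝ)).1 h.contDiff).2, fun u hu => ?_⟩
  have : Θ =ᶠ[nhds u] fun _ => 0 := by
    filter_upwards [isClosed_Icc.isOpen_compl.mem_nhds hu] with v hv using h.eq_zero v hv
  rw [this.deriv_eq, deriv_const]

theorem hasDerivAt (h : IsAnnularCutoff Θ) (u : ℝ) : HasDerivAt Θ (_root_.deriv Θ u) u :=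
  (h.contDiff.differentiable (by simp) u).hasDerivAt

theorem exists_bound (h : IsAnnularCutoff Θ) : ∃ M : ℝ, 0 ≤ M ∧ ∀ u, |Θ u| ≤ M := by
  have hc : HasCompactSupport Θ :=
    HasCompactSupport.intro (K := Set.Icc (1 / 4 : ℝ) 4) isCompact_Icc h.eq_zero
  obtain ⟨M, hM⟩ := hc.exists_bound_of_continuous h.continuous
  exact ⟨M, (abs_nonneg _).trans (hM 0), hM⟩

theorem abs_div_le (h : IsAnnularCutoff Θ) {M : ℝ} (hM : ∀ u, |Θ u| ≤ M) (u : ℝ) :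
    |Θ u / u| ≤ 4 * M := by
  have hM0 : 0 ≤ M := (abs_nonneg _).trans (hM 0)
  by_cases hu : u ∈ Set.Icc (1 / 4 : ℝ) 4
  · have h0 : 0 < u := by linarith [hu.1]
    rw [abs_div, abs_of_pos h0, div_le_iff₀ h0]
    nlinarith [hM u, hu.1]
  · rw [h.eq_zero u hu]
    simp [hM0]

end IsAnnularCutoff

/-! ### Radial oscillatory integrals -/

/-- `√(a² + r²)`, the norm of a vector with orthogonal components of lengths `|a|` and `|r|`. -/
def hypot (a r : ℝ) : ℝ := √(a ^ 2 + r ^ 2)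

theorem hypot_pos {a : ℝ} (ha : a ≠ 0) (r : ℝ) : 0 < hypot a r := by
  unfold hypot
  positivity

theorem hypot_sq (a r : ℝ) : hypot a r ^ 2 = a ^ 2 + r ^ 2 := Real.sq_sqrt (by positivity)

theorem abs_left_le_hypot (a r : ℝ) : |a| ≤ hypot a r :=
  Real.abs_le_sqrt (by nlinarith [sq_nonneg r])

theorem abs_right_le_hypot (a r : ℝ) : |r| ≤ hypot a r :=
  Real.abs_le_sqrt (by nlinarith [sq_nonneg a])

theorem continuous_hypot (a : ℝ) : Continuous (hypot a) := by
  unfold hypot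
  fun_prop

theorem hasDerivAt_hypot {a : ℝ} (ha : a ≠ 0) (r : ℝ) :
    HasDerivAt (hypot a) (r / hypot a r) r := by
  have h := (((hasDerivAt_id r).pow 2).const_add (a ^ 2)).sqrt
    (by simp only [id, Pi.pow_apply]; positivity)
  refine h.congr_deriv ?_
  simp [hypot]
  field_simp

/-- The oscillating factor `e^{is√(a²+r²)}`. -/
def radialPhase (s a r : ℝ) : ℂ := Complex.exp (Complex.I * ((s * hypot a r : ℝ) : ℂ))

theorem norm_radialPhase (s a r : ℝ) : ‖radialPhase s a r‖ = 1 := by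
  rw [radialPhase, mul_comm]
  exact Complex.norm_exp_ofReal_mul_I _

theorem continuous_radialPhase (s a : ℝ) : Continuous (radialPhase s a) := by
  have := continuous_hypot a
  unfold radialPhase
  fun_prop

theorem hasDerivAt_radialPhase (s : ℝ) {a : ℝ} (ha : a ≠ 0) (r : ℝ) :
    HasDerivAt (radialPhase s a)
      (radialPhase s a r * (Complex.I * ((s * (r / hypot a r) : ℝ) : ℂ))) r := by
  have h := ((((hasDerivAt_hypot ha r).const_mul s).ofReal_comp).const_mul Complex.I).cexp
  exact h

theorem hasDerivAt_radialPhase_mul (s : ℝ) {a : ℝ} (ha : a ≠ 0) {Θ : ℝ → ℝ}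
    (hΘ : IsAnnularCutoff Θ) {q : ℝ → ℝ} {q' r : ℝ} (hq : HasDerivAt q q' r) :
    HasDerivAt (fun r => radialPhase s a r * ((q r * Θ (hypot a r) : ℝ) : ℂ))
      (Complex.I * s * (radialPhase s a r * ((q r * r * (Θ (hypot a r) / hypot a r) : ℝ) : ℂ))
        + radialPhase s a r * ((q' * Θ (hypot a r) : ℝ) : ℂ)
        + radialPhase s a r * ((q r * r * (deriv Θ (hypot a r) / hypot a r) : ℝ) : ℂ)) r := by
  have h1 : HasDerivAt (fun r => q r * Θ (hypot a r))
      (q' * Θ (hypot a r) + q r * (deriv Θ (hypot a r) * (r / hypot a r))) r :=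
    hq.mul ((hΘ.hasDerivAt _).comp r (hasDerivAt_hypot ha r))
  refine ((hasDerivAt_radialPhase s ha r).mul h1.ofReal_comp).congr_deriv ?_
  push_cast
  ring

/-- `∫₀⁵ e^{is√(a²+r²)} r^k Θ(√(a²+r²)) / √(a²+r²) dr`. -/
def radialIntegral (k : ℕ) (Θ : ℝ → ℝ) (a s : ℝ) : ℂ :=
  ∫ r in (0 : ℝ)..5, radialPhase s a r * ((r ^ k * (Θ (hypot a r) / hypot a r) : ℝ) : ℂ)

section

variable {Θ : ℝ → ℝ} {a : ℝ}

theorem continuous_radialIntegrand (hΘ : IsAnnularCutoff Θ) (ha : a ≠ 0) (k : ℕ) (s : ℝ) :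
    Continuous fun r : ℝ =>
      radialPhase s a r * ((r ^ k * (Θ (hypot a r) / hypot a r) : ℝ) : ℂ) := by
  have h1 := continuous_radialPhase s a
  have h2 := hΘ.continuous.comp (continuous_hypot a)
  have h3 : Continuous fun r => Θ (hypot a r) / hypot a r :=
    h2.div (continuous_hypot a) fun r => (hypot_pos ha r).ne'
  fun_prop

theorem cutoff_hypot_eq_zero (hΘ : IsAnnularCutoff Θ) {r : ℝ} (h : 4 < |a| ∨ 4 < |r|) :
    Θ (hypot a r) = 0 := by
  refine hΘ.eq_zero _ fun hm => ?_
  rcases h with h | h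
  · linarith [abs_left_le_hypot a r, hm.2]
  · linarith [abs_right_le_hypot a r, hm.2]

theorem radialIntegral_eq_zero (hΘ : IsAnnularCutoff Θ) (h : 4 < |a|) (k : ℕ) (s : ℝ) :
    radialIntegral k Θ a s = 0 := by
  simp [radialIntegral, cutoff_hypot_eq_zero hΘ (Or.inl h)]

/-- Integration by parts with a free weight `q`. The phase derivative `s r / hypot a r` supplies the
factor `r / hypot a r`, which is why amplitudes carry `Θ / hypot`. The weights used below are
`r^(k+1)`, `1` and `1/r`. -/
theorem intervalIntegral_deriv_radialPhase_mul (hΘ : IsAnnularCutoff Θ) (ha : a ≠ 0) (s : ℝ)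
    {q q' : ℝ → ℝ} {b : ℝ} (hb : b ≤ 5) (hq : ∀ r ∈ Set.Icc b 5, HasDerivAt q (q' r) r)
    (hq' : ContinuousOn q' (Set.Icc b 5)) :
    Complex.I * s * (∫ r in b..5,
        radialPhase s a r * ((q r * r * (Θ (hypot a r) / hypot a r) : ℝ) : ℂ))
      + (∫ r in b..5, radialPhase s a r * ((q' r * Θ (hypot a r) : ℝ) : ℂ))
      + (∫ r in b..5, radialPhase s a r *
          ((q r * r * (deriv Θ (hypot a r) / hypot a r) : ℝ) : ℂ))
      = -(radialPhase s a b * ((q b * Θ (hypot a b) : ℝ) : ℂ)) := by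
  have hu : Set.uIcc b 5 = Set.Icc b 5 := Set.uIcc_of_le hb
  have hqc : ContinuousOn q (Set.Icc b 5) := fun r hr => (hq r hr).continuousAt.continuousWithinAt
  have hP : ContinuousOn (radialPhase s a) (Set.Icc b 5) := (continuous_radialPhase s a).continuousOn
  have hT : ∀ {T : ℝ → ℝ}, IsAnnularCutoff T →
      ContinuousOn (fun r => T (hypot a r)) (Set.Icc b 5) := fun h =>
    (h.continuous.comp (continuous_hypot a)).continuousOn
  have hD : ∀ {T : ℝ → ℝ}, IsAnnularCutoff T →
      ContinuousOn (fun r => T (hypot a r) / hypot a r) (Set.Icc b 5) := fun h =>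
    (hT h).div (continuous_hypot a).continuousOn fun r _ => (hypot_pos ha r).ne'
  have hR : ∀ {p : ℝ → ℝ}, ContinuousOn p (Set.Icc b 5) →
      IntervalIntegrable (fun r => radialPhase s a r * ((p r : ℝ) : ℂ)) volume b 5 := fun hp =>
    ContinuousOn.intervalIntegrable
      (by rw [hu]; exact hP.mul (Complex.continuous_ofReal.comp_continuousOn hp))
  have i1 := hR (p := fun r => q r * r * (Θ (hypot a r) / hypot a r)) ((hqc.mul continuousOn_id).mul (hD hΘ))
  have i2 := hR (p := fun r => q' r * Θ (hypot a r)) (hq'.mul (hT hΘ))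
  have i3 := hR (p := fun r => q r * r * (deriv Θ (hypot a r) / hypot a r)) ((hqc.mul continuousOn_id).mul (hD hΘ.deriv))
  have hF := intervalIntegral.integral_eq_sub_of_hasDerivAt
    (fun r hr => hasDerivAt_radialPhase_mul s ha hΘ (hq r (hu ▸ hr)))
    (((i1.const_mul (Complex.I * s)).add i2).add i3)
  -- The endpoint 5 lies beyond the support radius 4, so only the lower boundary term survives.
  have h5 : Θ (hypot a 5) = 0 := cutoff_hypot_eq_zero hΘ (Or.inr (by norm_num))
  rw [h5] at hF
  simp only [mul_zero, Complex.ofReal_zero, zero_sub] at hF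
  rw [← hF, ← intervalIntegral.integral_const_mul, ← intervalIntegral.integral_add
    (i1.const_mul (Complex.I * s)) i2, ← intervalIntegral.integral_add
    ((i1.const_mul (Complex.I * s)).add i2) i3]

theorem norm_radialIntegral_le (hΘ : IsAnnularCutoff Θ) {M : ℝ} (hM : ∀ u, |Θ u| ≤ M)
    (k : ℕ) (a s : ℝ) : ‖radialIntegral k Θ a s‖ ≤ 5 ^ k * (4 * M) * 5 := by
  have h := intervalIntegral.norm_integral_le_of_norm_le_const (a := (0 : ℝ)) (b := 5)
    (C := 5 ^ k * (4 * M))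
    (f := fun r => radialPhase s a r * ((r ^ k * (Θ (hypot a r) / hypot a r) : ℝ) : ℂ)) ?_
  · rwa [sub_zero, abs_of_pos (by norm_num : (0 : ℝ) < 5)] at h
  · intro r hr
    rw [Set.uIoc_of_le (by norm_num)] at hr
    rw [norm_mul, norm_radialPhase, one_mul, Complex.norm_real, Real.norm_eq_abs, abs_mul, abs_pow,
      abs_of_pos hr.1]
    gcongr
    · exact hr.1.le
    · exact hr.2
    · exact hΘ.abs_div_le hM _

/-- The weight `r^(k+1)` kills the boundary term at 0. Writing `r² = hypot² - a²` in the term with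
`deriv Θ` brings its power down to `k`, so a factor `1/s` is gained for two powers of `r`. -/
theorem radialIntegral_add_two (hΘ : IsAnnularCutoff Θ) (ha : a ≠ 0) (k : ℕ) (s : ℝ) :
    Complex.I * s * radialIntegral (k + 2) Θ a s =
      -((k + 1 : ℝ) * radialIntegral k (fun u => u * Θ u) a s
        + (radialIntegral k (fun u => u ^ 2 * deriv Θ u) a s
          - (a ^ 2 : ℝ) * radialIntegral k (deriv Θ) a s)) := by
  have h := intervalIntegral_deriv_radialPhase_mul hΘ ha s (b := 0) (by norm_num)
    (q := fun r => r ^ (k + 1)) (q' := fun r => ((k + 1 : ℕ) : ℝ) * r ^ k)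
    (fun r _ => by simpa using hasDerivAt_pow (k + 1) r) (by fun_prop)
  simp only [ne_eq, Nat.add_eq_zero_iff, one_ne_zero, and_false, not_false_eq_true, zero_pow,
    zero_mul, Complex.ofReal_zero, mul_zero, neg_zero] at h
  have e1 : (∫ r in (0 : ℝ)..5, radialPhase s a r *
      ((r ^ (k + 1) * r * (Θ (hypot a r) / hypot a r) : ℝ) : ℂ)) = radialIntegral (k + 2) Θ a s :=
    rfl
  have e2 : (∫ r in (0 : ℝ)..5, radialPhase s a r *
      ((((k + 1 : ℕ) : ℝ) * r ^ k * Θ (hypot a r) : ℝ) : ℂ))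
      = (k + 1 : ℝ) * radialIntegral k (fun u => u * Θ u) a s := by
    rw [radialIntegral, ← intervalIntegral.integral_const_mul]
    congr 1
    funext r
    rw [mul_div_cancel_left₀ _ (hypot_pos ha r).ne']
    push_cast
    ring
  have e3 : (∫ r in (0 : ℝ)..5, radialPhase s a r *
      ((r ^ (k + 1) * r * (deriv Θ (hypot a r) / hypot a r) : ℝ) : ℂ))
      = radialIntegral k (fun u => u ^ 2 * deriv Θ u) a s
          - (a ^ 2 : ℝ) * radialIntegral k (deriv Θ) a s := by
    have hc : IsAnnularCutoff (fun u => u ^ 2 * deriv Θ u) := hΘ.deriv.mul_left (by fun_prop)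
    rw [radialIntegral, radialIntegral, ← intervalIntegral.integral_const_mul,
      ← intervalIntegral.integral_sub
        ((continuous_radialIntegrand hc ha k s).intervalIntegrable _ _)
        (((continuous_radialIntegrand hΘ.deriv ha k s).const_mul _).intervalIntegrable _ _)]
    congr 1
    funext r
    have : r ^ 2 = hypot a r ^ 2 - a ^ 2 := by rw [hypot_sq]; ring
    rw [pow_succ, mul_assoc (r ^ k), ← sq, this]
    push_cast
    ring
  rw [e1, e2, e3] at h
  linear_combination h

theorem radialIntegral_one (hΘ : IsAnnularCutoff Θ) (ha : a ≠ 0) (s : ℝ) :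
    Complex.I * s * radialIntegral 1 Θ a s =
      -(radialPhase s a 0 * (Θ (hypot a 0) : ℂ) + radialIntegral 1 (deriv Θ) a s) := by
  have h := intervalIntegral_deriv_radialPhase_mul hΘ ha s (b := 0) (by norm_num)
    (q := fun r => 1) (q' := fun r => 0) (fun r _ => hasDerivAt_const r 1) (by fun_prop)
  simp only [one_mul, zero_mul, Complex.ofReal_zero, mul_zero, intervalIntegral.integral_zero,
    add_zero] at h
  simp only [radialIntegral, pow_one]
  linear_combination h

end

/-- A van der Corput argument: `[0, δ]` is estimated by its length, and on `[δ, 5]` integration by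
parts with weight `1/r` costs `O(1/δ)`. As `1/|s| = δ²`, both parts are `O(δ)`. -/
theorem exists_norm_radialIntegral_zero_le {Θ : ℝ → ℝ} (hΘ : IsAnnularCutoff Θ) :
    ∃ C : ℝ, 0 ≤ C ∧ ∀ a s δ : ℝ, a ≠ 0 → 0 < δ → δ ≤ 1 → |s| * δ ^ 2 = 1 →
      ‖radialIntegral 0 Θ a s‖ ≤ C * δ := by
  obtain ⟨M, hM0, hM⟩ := hΘ.exists_bound
  obtain ⟨M', hM0', hM'⟩ := hΘ.deriv.exists_bound
  refine ⟨4 * M + (2 * M + 20 * M'), by positivity, fun a s δ ha hδ hδ1 hs => ?_⟩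
  have hc := continuous_radialIntegrand hΘ ha 0 s
  have hsplit := intervalIntegral.integral_add_adjacent_intervals
    (hc.intervalIntegrable (μ := volume) 0 δ) (hc.intervalIntegrable (μ := volume) δ 5)
  have hsmall := intervalIntegral.norm_integral_le_of_norm_le_const (a := (0 : ℝ)) (b := δ)
    (C := 4 * M)
    (f := fun r => radialPhase s a r * ((r ^ 0 * (Θ (hypot a r) / hypot a r) : ℝ) : ℂ))
    (fun r _ => by
      rw [norm_mul, norm_radialPhase, one_mul, Complex.norm_real, Real.norm_eq_abs, pow_zero,
        one_mul]
      exact hΘ.abs_div_le hM _)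
  rw [sub_zero, abs_of_pos hδ] at hsmall
  have h := intervalIntegral_deriv_radialPhase_mul hΘ ha s (b := δ) (by linarith)
    (q := fun r => r⁻¹) (q' := fun r => -(r ^ 2)⁻¹)
    (fun r hr => hasDerivAt_inv (hδ.trans_le hr.1).ne')
    (ContinuousOn.neg (ContinuousOn.inv₀ (by fun_prop)
      fun r hr => pow_ne_zero 2 (hδ.trans_le hr.1).ne'))
  set X := ∫ r in δ..5, radialPhase s a r * ((r ^ 0 * (Θ (hypot a r) / hypot a r) : ℝ) : ℂ) with hX
  have hcongr : ∀ T : ℝ → ℝ, (∫ r in δ..5, radialPhase s a r *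
        ((r⁻¹ * r * (T (hypot a r) / hypot a r) : ℝ) : ℂ))
      = ∫ r in δ..5, radialPhase s a r * ((r ^ 0 * (T (hypot a r) / hypot a r) : ℝ) : ℂ) := by
    intro T
    refine intervalIntegral.integral_congr fun r hr => ?_
    rw [Set.uIcc_of_le (by linarith)] at hr
    simp only [inv_mul_cancel₀ (hδ.trans_le hr.1).ne', pow_zero]
  rw [hcongr, hcongr, ← hX] at h
  have hZ : ‖∫ r in δ..5, radialPhase s a r *
      ((r ^ 0 * (deriv Θ (hypot a r) / hypot a r) : ℝ) : ℂ)‖ ≤ 20 * M' := by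
    refine (intervalIntegral.norm_integral_le_of_norm_le_const (C := 4 * M') fun r _ => ?_).trans ?_
    · rw [norm_mul, norm_radialPhase, one_mul, Complex.norm_real, Real.norm_eq_abs, pow_zero,
        one_mul]
      exact hΘ.deriv.abs_div_le hM' _
    · rw [abs_of_nonneg (by linarith)]
      nlinarith
  have hY : ‖∫ r in δ..5, radialPhase s a r * ((-(r ^ 2)⁻¹ * Θ (hypot a r) : ℝ) : ℂ)‖
      ≤ M * δ⁻¹ := by
    have hint : IntervalIntegrable (fun r : ℝ => M * (r ^ 2)⁻¹) volume δ 5 := by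
      refine ContinuousOn.intervalIntegrable ?_
      rw [Set.uIcc_of_le (by linarith)]
      exact continuousOn_const.mul (ContinuousOn.inv₀ (by fun_prop)
        fun r hr => pow_ne_zero 2 (hδ.trans_le hr.1).ne')
    refine (intervalIntegral.norm_integral_le_of_norm_le (by linarith)
      (Filter.Eventually.of_forall fun r hr => ?_) hint).trans ?_
    · have hr0 : 0 < r := hδ.trans hr.1
      rw [norm_mul, norm_radialPhase, one_mul, Complex.norm_real, Real.norm_eq_abs, abs_mul,
        abs_neg, abs_of_pos (by positivity : 0 < (r ^ 2)⁻¹), mul_comm]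
      gcongr
      exact hM _
    · rw [intervalIntegral.integral_eq_sub_of_hasDerivAt (f := fun r => M * (-r⁻¹))
        (fun r hr => ?_) hint]
      · have : 0 ≤ M * (5 : ℝ)⁻¹ := by positivity
        linarith
      · rw [Set.uIcc_of_le (by linarith)] at hr
        simpa using ((hasDerivAt_inv (hδ.trans_le hr.1).ne').neg.const_mul M)
  have hW : ‖radialPhase s a δ * ((δ⁻¹ * Θ (hypot a δ) : ℝ) : ℂ)‖ ≤ M * δ⁻¹ := by
    rw [norm_mul, norm_radialPhase, one_mul, Complex.norm_real, Real.norm_eq_abs, abs_mul,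
      abs_of_pos (inv_pos.2 hδ), mul_comm]
    gcongr
    exact hM _
  have hsX : |s| * ‖X‖ ≤ M * δ⁻¹ + M * δ⁻¹ + 20 * M' := by
    have e : ‖Complex.I * s * X‖ = |s| * ‖X‖ := by simp
    rw [← e, show Complex.I * s * X = -(radialPhase s a δ * ((δ⁻¹ * Θ (hypot a δ) : ℝ) : ℂ))
        - (∫ r in δ..5, radialPhase s a r * ((-(r ^ 2)⁻¹ * Θ (hypot a r) : ℝ) : ℂ))
        - (∫ r in δ..5, radialPhase s a r *
            ((r ^ 0 * (deriv Θ (hypot a r) / hypot a r) : ℝ) : ℂ)) by linear_combination h]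
    refine (norm_sub_le _ _).trans (add_le_add ((norm_sub_le _ _).trans (add_le_add ?_ hY)) hZ)
    rwa [norm_neg]
  have hXle : ‖X‖ ≤ (2 * M + 20 * M') * δ := by
    calc ‖X‖ = δ ^ 2 * (|s| * ‖X‖) := by linear_combination -‖X‖ * hs
      _ ≤ δ ^ 2 * (M * δ⁻¹ + M * δ⁻¹ + 20 * M') := by gcongr
      _ = 2 * M * δ + 20 * M' * (δ * δ) := by field_simp; ring
      _ ≤ 2 * M * δ + 20 * M' * (δ * 1) := by gcongr
      _ = _ := by ring
  rw [radialIntegral, ← hsplit, add_mul]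
  exact (norm_add_le _ _).trans (add_le_add hsmall hXle)

theorem exists_norm_radialIntegral_one_le {Θ : ℝ → ℝ} (hΘ : IsAnnularCutoff Θ) :
    ∃ C : ℝ, 0 ≤ C ∧ ∀ a s δ : ℝ, a ≠ 0 → 0 < δ → δ ≤ 1 → |s| * δ ^ 2 = 1 →
      ‖radialIntegral 1 Θ a s‖ ≤ C * δ ^ 2 := by
  obtain ⟨M, hM0, hM⟩ := hΘ.exists_bound
  obtain ⟨M', hM0', hM'⟩ := hΘ.deriv.exists_bound
  refine ⟨M + 5 ^ 1 * (4 * M') * 5, by positivity, fun a s δ ha hδ hδ1 hs => ?_⟩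
  have h : |s| * ‖radialIntegral 1 Θ a s‖ ≤ M + 5 ^ 1 * (4 * M') * 5 := by
    have e : ‖Complex.I * s * radialIntegral 1 Θ a s‖ = |s| * ‖radialIntegral 1 Θ a s‖ := by simp
    rw [← e, radialIntegral_one hΘ ha, norm_neg]
    refine (norm_add_le _ _).trans (add_le_add ?_ (norm_radialIntegral_le hΘ.deriv hM' 1 a s))
    rw [norm_mul, norm_radialPhase, one_mul, Complex.norm_real]
    exact hM _
  calc ‖radialIntegral 1 Θ a s‖ = |s| * ‖radialIntegral 1 Θ a s‖ * δ ^ 2 := by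
        linear_combination -‖radialIntegral 1 Θ a s‖ * hs
    _ ≤ _ := by gcongr

/-- The radial oscillatory integral decays like `|s|^{-(k+1)/2}`, uniformly in `a`; here
`δ = |s|^{-1/2}`. -/
theorem exists_norm_radialIntegral_le (k : ℕ) : ∀ {Θ : ℝ → ℝ}, IsAnnularCutoff Θ →
    ∃ C : ℝ, 0 ≤ C ∧ ∀ a s δ : ℝ, a ≠ 0 → 0 < δ → δ ≤ 1 → |s| * δ ^ 2 = 1 →
      ‖radialIntegral k Θ a s‖ ≤ C * δ ^ (k + 1) := by
  -- The claim is for all cutoffs at once, because the recursion replaces `Θ` by `uΘ`, `u²Θ'` and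
  -- `Θ'`.
  induction k using Nat.twoStepInduction with
  | zero => simpa using fun {Θ} (hΘ : IsAnnularCutoff Θ) => exists_norm_radialIntegral_zero_le hΘ
  | one => exact fun hΘ => exists_norm_radialIntegral_one_le hΘ
  | more k ih _ =>
    intro Θ hΘ
    obtain ⟨C₁, hC₁, h₁⟩ := ih (hΘ.mul_left (p := fun u => u) (by fun_prop))
    obtain ⟨C₂, hC₂, h₂⟩ := ih (hΘ.deriv.mul_left (p := fun u => u ^ 2) (by fun_prop))
    obtain ⟨C₃, hC₃, h₃⟩ := ih hΘ.deriv
    refine ⟨(k + 1) * C₁ + (C₂ + 16 * C₃), by positivity, fun a s δ ha hδ hδ1 hs => ?_⟩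
    -- The recursion has the coefficient `a²`; uniformity in `a` holds because the integral vanishes
    -- unless `a² ≤ 16`.
    rcases lt_or_ge 4 |a| with h4 | h4
    · rw [radialIntegral_eq_zero hΘ h4, norm_zero]
      positivity
    have ha2 : a ^ 2 ≤ 16 := by
      rw [← sq_abs]
      nlinarith [abs_nonneg a]
    have h : |s| * ‖radialIntegral (k + 2) Θ a s‖
        ≤ (k + 1) * (C₁ * δ ^ (k + 1)) + (C₂ * δ ^ (k + 1) + 16 * (C₃ * δ ^ (k + 1))) := by
      have e : ‖Complex.I * s * radialIntegral (k + 2) Θ a s‖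
          = |s| * ‖radialIntegral (k + 2) Θ a s‖ := by simp
      rw [← e, radialIntegral_add_two hΘ ha, norm_neg]
      refine (norm_add_le _ _).trans (add_le_add ?_ ((norm_sub_le _ _).trans (add_le_add ?_ ?_)))
      · rw [norm_mul, Complex.norm_real, Real.norm_of_nonneg (by positivity)]
        gcongr
        exact h₁ a s δ ha hδ hδ1 hs
      · exact h₂ a s δ ha hδ hδ1 hs
      · rw [norm_mul, Complex.norm_real, Real.norm_of_nonneg (by positivity)]
        gcongr
        exact h₃ a s δ ha hδ hδ1 hs
    calc ‖radialIntegral (k + 2) Θ a s‖ = |s| * ‖radialIntegral (k + 2) Θ a s‖ * δ ^ 2 := by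
          linear_combination -‖radialIntegral (k + 2) Θ a s‖ * hs
      _ ≤ _ := by
        refine (mul_le_mul_of_nonneg_right h (by positivity)).trans_eq ?_
        ring

/-! ### Polar coordinates -/

section Polar

variable {E : Type*} [NormedAddCommGroup E] [NormedSpace ℝ E] [FiniteDimensional ℝ E]
  [MeasurableSpace E] [BorelSpace E] [Nontrivial E]

/-- Bounding an integral by its integrals along the rays from the origin. -/
theorem norm_integral_le_of_polar (μ : Measure E) [μ.IsAddHaarMeasure] {F : E → ℂ}
    (hF : Integrable F μ) {B : ℝ}
    (hB : ∀ ω : E, ‖ω‖ = 1 →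
      ‖∫ r in Set.Ioi (0 : ℝ), ((r ^ (Module.finrank ℝ E - 1) : ℝ) : ℂ) * F (r • ω)‖ ≤ B) :
    ‖∫ y, F y ∂μ‖ ≤ B * μ.toSphere.real Set.univ := by
  set G : Metric.sphere (0 : E) 1 × Set.Ioi (0 : ℝ) → ℂ := fun p => F ((p.2 : ℝ) • (p.1 : E))
  have hG : ∀ y : ({0}ᶜ : Set E), G (homeomorphUnitSphereProd E y) = F y := by
    rintro ⟨y, hy⟩
    have hy0 : ‖y‖ ≠ 0 := by simpa using hy
    simp [G, homeomorphUnitSphereProd, smul_smul, hy0]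
  have hmp := μ.measurePreserving_homeomorphUnitSphereProd
  have hemb := (homeomorphUnitSphereProd E).measurableEmbedding
  have hGi : Integrable G (μ.toSphere.prod (.volumeIoiPow (Module.finrank ℝ E - 1))) := by
    rw [← hmp.integrable_comp_emb hemb]
    have : G ∘ homeomorphUnitSphereProd E = F ∘ (Subtype.val : ({0}ᶜ : Set E) → E) := funext hG
    rw [this, ← integrableOn_iff_comap_subtypeVal (measurableSet_singleton (0 : E)).compl]
    exact hF.integrableOn
  have h1 : ∫ y, F y ∂μ = ∫ p, G p ∂(μ.toSphere.prod (.volumeIoiPow (Module.finrank ℝ E - 1))) := by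
    rw [← hmp.integral_comp hemb]
    simp only [hG]
    rw [integral_subtype_comap (measurableSet_singleton (0 : E)).compl fun y => F y,
      restrict_compl_singleton]
  rw [h1, integral_prod _ hGi]
  -- The modulus enters only at the spherical integral, so the cancellation along each ray is kept.
  refine norm_integral_le_of_norm_le_const (Filter.Eventually.of_forall fun ω => ?_)
  refine le_of_eq_of_le (congrArg norm ?_) (hB ω (by simp))
  simp only [Measure.volumeIoiPow, ENNReal.ofReal, G]
  rw [integral_withDensity_eq_integral_smul
      (measurable_subtype_coe.pow_const _).real_toNNReal,
    integral_subtype_comap measurableSet_Ioi fun r : ℝ =>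
      Real.toNNReal (r ^ (Module.finrank ℝ E - 1)) • F (r • (ω : E)),
    setIntegral_congr_fun measurableSet_Ioi fun r hr => ?_]
  rw [NNReal.smul_def, Real.coe_toNNReal _ (pow_nonneg (Set.mem_Ioi.1 hr).le _), Complex.real_smul]

end Polar

/-! ### Decay on one slice -/

section Slice

variable {m : ℕ}

/-- The integrand of the kernel on the slice at height `a`, without the linear phase. -/
def sliceIntegrand (Ψ : ℝ → ℝ) (s a α β : ℝ) (v w y : EuclideanSpace ℝ (Fin m)) : ℂ :=
  radialPhase s a ‖y‖ * ((Ψ (hypot a ‖y‖) * (α * a + inner ℝ v y) * (β * a + inner ℝ w y) : ℝ) : ℂ)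

theorem continuous_sliceIntegrand {Ψ : ℝ → ℝ} (hΨ : IsAnnularCutoff Ψ) (s a α β : ℝ)
    (v w : EuclideanSpace ℝ (Fin m)) : Continuous (sliceIntegrand Ψ s a α β v w) := by
  have h1 := (continuous_radialPhase s a).comp (continuous_norm (E := EuclideanSpace ℝ (Fin m)))
  have h2 := hΨ.continuous.comp ((continuous_hypot a).comp
    (continuous_norm (E := EuclideanSpace ℝ (Fin m))))
  simp only [Function.comp_def] at h1 h2
  exact h1.mul (Complex.continuous_ofReal.comp ((h2.mul (by fun_prop)).mul (by fun_prop)))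

theorem integrable_sliceIntegrand {Ψ : ℝ → ℝ} (hΨ : IsAnnularCutoff Ψ) (s a α β : ℝ)
    (v w : EuclideanSpace ℝ (Fin m)) : Integrable (sliceIntegrand Ψ s a α β v w) := by
  refine (continuous_sliceIntegrand hΨ s a α β v w).integrable_of_hasCompactSupport
    (HasCompactSupport.intro (K := Metric.closedBall 0 4) (isCompact_closedBall _ _) fun y hy => ?_)
  have : 4 < |‖y‖| := by simpa using hy
  simp [sliceIntegrand, cutoff_hypot_eq_zero hΨ (Or.inr this)]

/-- Along a ray the two linear factors multiply to a quadratic polynomial in `r`. The cutoff `uΨ(u)`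
absorbs the division by `hypot` in `radialIntegral`. -/
theorem integral_ray_sliceIntegrand {Ψ : ℝ → ℝ} (hΨ : IsAnnularCutoff Ψ) (k : ℕ) (s : ℝ) {a : ℝ}
    (ha : a ≠ 0) (α β : ℝ) (v w : EuclideanSpace ℝ (Fin m)) {ω : EuclideanSpace ℝ (Fin m)}
    (hω : ‖ω‖ = 1) :
    ∫ r in Set.Ioi (0 : ℝ), ((r ^ k : ℝ) : ℂ) * sliceIntegrand Ψ s a α β v w (r • ω)
      = ((α * β * a ^ 2 : ℝ) : ℂ) * radialIntegral k (fun u => u * Ψ u) a s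
        + ((a * (α * inner ℝ w ω + β * inner ℝ v ω) : ℝ) : ℂ) *
            radialIntegral (k + 1) (fun u => u * Ψ u) a s
        + ((inner ℝ v ω * inner ℝ w ω : ℝ) : ℂ) *
            radialIntegral (k + 2) (fun u => u * Ψ u) a s := by
  have hΘ : IsAnnularCutoff (fun u => u * Ψ u) := hΨ.mul_left (p := fun u => u) (by fun_prop)
  have hi : ∀ j, IntervalIntegrable (fun r : ℝ => radialPhase s a r *
      ((r ^ j * (hypot a r * Ψ (hypot a r) / hypot a r) : ℝ) : ℂ)) volume 0 5 := fun j =>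
    (continuous_radialIntegrand hΘ ha j s).intervalIntegrable _ _
  have h5 : ∫ r in Set.Ioi (0 : ℝ), ((r ^ k : ℝ) : ℂ) * sliceIntegrand Ψ s a α β v w (r • ω)
      = ∫ r in (0 : ℝ)..5, ((r ^ k : ℝ) : ℂ) * sliceIntegrand Ψ s a α β v w (r • ω) := by
    rw [intervalIntegral.integral_of_le (by norm_num)]
    refine setIntegral_eq_of_subset_of_forall_sdiff_eq_zero measurableSet_Ioi
      (fun r hr => hr.1) fun r hr => ?_
    have hr5 : 5 < r := by
      by_contra h
      exact hr.2 ⟨hr.1, not_lt.1 h⟩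
    have : 4 < |‖r • ω‖| := by
      rw [norm_smul, hω, mul_one, abs_norm, Real.norm_eq_abs, abs_of_pos hr.1]
      linarith
    simp [sliceIntegrand, cutoff_hypot_eq_zero hΨ (Or.inr this)]
  rw [h5]
  simp only [radialIntegral]
  rw [← intervalIntegral.integral_const_mul, ← intervalIntegral.integral_const_mul,
    ← intervalIntegral.integral_const_mul,
    ← intervalIntegral.integral_add ((hi k).const_mul _) ((hi (k + 1)).const_mul _),
    ← intervalIntegral.integral_add (((hi k).const_mul _).add ((hi (k + 1)).const_mul _))
      ((hi (k + 2)).const_mul _)]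
  refine intervalIntegral.integral_congr fun r hr => ?_
  rw [Set.uIcc_of_le (by norm_num)] at hr
  have hn : ‖r • ω‖ = r := by rw [norm_smul, hω, mul_one, Real.norm_of_nonneg hr.1]
  simp only [sliceIntegrand, hn, inner_smul_right, mul_div_cancel_left₀ _ (hypot_pos ha r).ne']
  push_cast
  ring

/-- The Jacobian `r^(m-1)` gives `δ^m`; the extra powers of `r` only improve this, since `δ ≤ 1`.
The indicator makes the bound integrable in `a`. -/
theorem exists_norm_integral_sliceIntegrand_le (hm : 1 ≤ m) {Ψ : ℝ → ℝ} (hΨ : IsAnnularCutoff Ψ) :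
    ∃ C : ℝ, 0 ≤ C ∧ ∀ (a s δ α β : ℝ) (v w : EuclideanSpace ℝ (Fin m)), a ≠ 0 → 0 < δ → δ ≤ 1 →
      |s| * δ ^ 2 = 1 → |α| ≤ 1 → |β| ≤ 1 → ‖v‖ ≤ 1 → ‖w‖ ≤ 1 →
      ‖∫ y, sliceIntegrand Ψ s a α β v w y‖
        ≤ (Set.Icc (-4 : ℝ) 4).indicator (fun _ => C * δ ^ m) a := by
  have hΘ : IsAnnularCutoff (fun u => u * Ψ u) := hΨ.mul_left (p := fun u => u) (by fun_prop)
  obtain ⟨k, rfl⟩ : ∃ k, m = k + 1 := ⟨m - 1, by omega⟩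
  obtain ⟨C₀, hC₀, h₀⟩ := exists_norm_radialIntegral_le k hΘ
  obtain ⟨C₁, hC₁, h₁⟩ := exists_norm_radialIntegral_le (k + 1) hΘ
  obtain ⟨C₂, hC₂, h₂⟩ := exists_norm_radialIntegral_le (k + 2) hΘ
  set σ := (volume : Measure (EuclideanSpace ℝ (Fin (k + 1)))).toSphere.real Set.univ
  have hσ : 0 ≤ σ := measureReal_nonneg
  -- For `|a| ≤ 4` the polynomial's coefficients are at most `4² = 16`, `4 · 2 = 8` and `1`; `σ` is
  -- the area of the sphere.
  refine ⟨(16 * C₀ + 8 * C₁ + C₂) * σ, by positivity,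
    fun a s δ α β v w ha hδ hδ1 hs hα hβ hv hw => ?_⟩
  by_cases ha4 : a ∈ Set.Icc (-4 : ℝ) 4
  · rw [Set.indicator_of_mem ha4, mul_right_comm]
    have ha' : |a| ≤ 4 := abs_le.2 ha4
    refine norm_integral_le_of_polar volume (integrable_sliceIntegrand hΨ s a α β v w)
      fun ω hω => ?_
    rw [finrank_euclideanSpace_fin, Nat.add_sub_cancel,
      integral_ray_sliceIntegrand hΨ k s ha α β v w hω]
    have hvω : |inner ℝ v ω| ≤ 1 := (abs_real_inner_le_norm v ω).trans (by rwa [hω, mul_one])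
    have hwω : |inner ℝ w ω| ≤ 1 := (abs_real_inner_le_norm w ω).trans (by rwa [hω, mul_one])
    have hp1 : δ ^ (k + 1 + 1) ≤ δ ^ (k + 1) := pow_le_pow_of_le_one hδ.le hδ1 (by omega)
    have hp2 : δ ^ (k + 2 + 1) ≤ δ ^ (k + 1) := pow_le_pow_of_le_one hδ.le hδ1 (by omega)
    have b0 : |α * β * a ^ 2| ≤ 16 := by
      rw [abs_mul, abs_mul, abs_pow]
      calc |α| * |β| * |a| ^ 2 ≤ 1 * 1 * 4 ^ 2 := by gcongr
        _ = 16 := by norm_num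
    have b1 : |a * (α * inner ℝ w ω + β * inner ℝ v ω)| ≤ 8 := by
      rw [abs_mul]
      calc |a| * |α * inner ℝ w ω + β * inner ℝ v ω|
          ≤ |a| * (|α| * |inner ℝ w ω| + |β| * |inner ℝ v ω|) := by
            gcongr
            exact (abs_add_le _ _).trans_eq (by rw [abs_mul, abs_mul])
        _ ≤ 4 * (1 * 1 + 1 * 1) := by gcongr
        _ = 8 := by norm_num
    have b2 : |inner ℝ v ω * inner ℝ w ω| ≤ 1 := by
      rw [abs_mul]
      exact mul_le_one₀ hvω (abs_nonneg _) hwω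
    rw [add_mul, add_mul]
    refine norm_add₃_le.trans (add_le_add (add_le_add ?_ ?_) ?_)
    · rw [norm_mul, Complex.norm_real, Real.norm_eq_abs, mul_assoc _ _ (δ ^ (k + 1))]
      gcongr
      exact h₀ a s δ ha hδ hδ1 hs
    · rw [norm_mul, Complex.norm_real, Real.norm_eq_abs, mul_assoc _ _ (δ ^ (k + 1))]
      gcongr
      exact (h₁ a s δ ha hδ hδ1 hs).trans (by gcongr)
    · rw [norm_mul, Complex.norm_real, Real.norm_eq_abs, ← one_mul (C₂ * _)]
      gcongr
      exact (h₂ a s δ ha hδ hδ1 hs).trans (by gcongr)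
  · have ha' : 4 < |a| := by
      by_contra h
      exact ha4 (abs_le.1 (not_lt.1 h))
    simp [sliceIntegrand, cutoff_hypot_eq_zero hΨ (Or.inl ha'), Set.indicator_of_notMem ha4]

end Slice

/-! ### Dispersive bound for the scalar kernel -/

/-- Any isometry `U₀` is corrected by the reflection that exchanges the equally long vectors `U₀ p`
and `q`. -/
theorem exists_linearIsometryEquiv_apply_eq {V W : Type*} [NormedAddCommGroup V]
    [InnerProductSpace ℝ V] [FiniteDimensional ℝ V] [NormedAddCommGroup W] [InnerProductSpace ℝ W]
    [FiniteDimensional ℝ W] (h : Module.finrank ℝ V = Module.finrank ℝ W) {p : V} {q : W}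
    (hpq : ‖p‖ = ‖q‖) : ∃ U : V ≃ₗᵢ[ℝ] W, U p = q := by
  let U₀ : V ≃ₗᵢ[ℝ] W := (stdOrthonormalBasis ℝ V).equiv (stdOrthonormalBasis ℝ W) (finCongr h)
  refine ⟨U₀.trans (Submodule.reflection (ℝ ∙ (U₀ p - q))ᗮ), ?_⟩
  simpa using Submodule.reflection_sub (v := U₀ p) (w := q) (by simpa using hpq)

/-- The integrand of the dispersive kernel. -/
def kernelIntegrand {n : ℕ} (Ψ : ℝ → ℝ) (s : ℝ) (x v w ξ : EuclideanSpace ℝ (Fin n)) : ℂ :=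
  Complex.exp (Complex.I * (inner ℝ x ξ : ℝ)) * (Complex.exp (Complex.I * ((s * ‖ξ‖ : ℝ) : ℂ)) *
    ((Ψ ‖ξ‖ * inner ℝ v ξ * inner ℝ w ξ : ℝ) : ℂ))

theorem kernelIntegrand_eq_zero {n : ℕ} {Ψ : ℝ → ℝ} (hΨ : IsAnnularCutoff Ψ) (s : ℝ)
    (x v w : EuclideanSpace ℝ (Fin n)) {ξ : EuclideanSpace ℝ (Fin n)} (h : 4 < ‖ξ‖) :
    kernelIntegrand Ψ s x v w ξ = 0 := by
  have : Ψ ‖ξ‖ = 0 := hΨ.eq_zero _ fun hm => absurd hm.2 (not_le.2 h)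
  simp [kernelIntegrand, this]

theorem continuous_kernelIntegrand {n : ℕ} {Ψ : ℝ → ℝ} (hΨ : IsAnnularCutoff Ψ) (s : ℝ)
    (x v w : EuclideanSpace ℝ (Fin n)) : Continuous (kernelIntegrand Ψ s x v w) := by
  have := hΨ.continuous
  unfold kernelIntegrand
  fun_prop

theorem integrable_kernelIntegrand {n : ℕ} {Ψ : ℝ → ℝ} (hΨ : IsAnnularCutoff Ψ) (s : ℝ)
    (x v w : EuclideanSpace ℝ (Fin n)) : Integrable (kernelIntegrand Ψ s x v w) := by
  refine (continuous_kernelIntegrand hΨ s x v w).integrable_of_hasCompactSupport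
    (HasCompactSupport.intro (K := Metric.closedBall 0 4) (isCompact_closedBall _ _) fun y hy => ?_)
  exact kernelIntegrand_eq_zero hΨ s x v w (by simpa using hy)

theorem exists_norm_integral_kernelIntegrand_le_pow {m : ℕ} (hm : 1 ≤ m) {Ψ : ℝ → ℝ}
    (hΨ : IsAnnularCutoff Ψ) :
    ∃ C : ℝ, 0 ≤ C ∧ ∀ (s δ : ℝ) (x v w : EuclideanSpace ℝ (Fin (m + 1))), 0 < δ → δ ≤ 1 →
      |s| * δ ^ 2 = 1 → ‖v‖ ≤ 1 → ‖w‖ ≤ 1 → ‖∫ ξ, kernelIntegrand Ψ s x v w ξ‖ ≤ C * δ ^ m := by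
  obtain ⟨C, hC, h⟩ := exists_norm_integral_sliceIntegrand_le hm hΨ
  -- The factor 8 is the length of `[-4, 4]`, the range of the height `a`.
  refine ⟨8 * C, by positivity, fun s δ x v w hδ hδ1 hs hv hw => ?_⟩
  let V := WithLp 2 (ℝ × EuclideanSpace ℝ (Fin m))
  let p : V := WithLp.toLp 2 ((1 : ℝ), (0 : EuclideanSpace ℝ (Fin m)))
  have hp : ‖p‖ = 1 := by
    rw [WithLp.prod_norm_eq_of_L2]
    simp [p]
  obtain ⟨e, he, hx⟩ : ∃ e : EuclideanSpace ℝ (Fin (m + 1)), ‖e‖ = 1 ∧ x = ‖x‖ • e := by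
    by_cases hx : x = 0
    · exact ⟨EuclideanSpace.single 0 1, by simp, by simp [hx]⟩
    · exact ⟨‖x‖⁻¹ • x, by simp [norm_smul, hx], by simp [smul_smul, hx]⟩
  obtain ⟨U, hU⟩ := exists_linearIsometryEquiv_apply_eq (V := V)
    (W := EuclideanSpace ℝ (Fin (m + 1))) (p := p) (q := e)
    (by rw [(WithLp.linearEquiv 2 ℝ (ℝ × EuclideanSpace ℝ (Fin m))).finrank_eq]; simp; omega)
    (by rw [hp, he])
  have hin : ∀ (z : EuclideanSpace ℝ (Fin (m + 1))) (a : ℝ) (y : EuclideanSpace ℝ (Fin m)),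
      inner ℝ z (U (WithLp.toLp 2 (a, y))) = (U.symm z).fst * a + inner ℝ (U.symm z).snd y := by
    intro z a y
    rw [← U.symm.inner_map_map, U.symm_apply_apply, WithLp.prod_inner_apply]
    simp [mul_comm]
  have hfst : ∀ z : V, |z.fst| ≤ ‖z‖ := fun z => WithLp.norm_fst_le _ z
  have hsnd : ∀ z : V, ‖z.snd‖ ≤ ‖z‖ := fun z => WithLp.norm_snd_le _ z
  have hcomp : ∀ (a : ℝ) (y : EuclideanSpace ℝ (Fin m)),
      kernelIntegrand Ψ s x v w (U (WithLp.toLp 2 (a, y)))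
        = Complex.exp (Complex.I * ((‖x‖ * a : ℝ) : ℂ)) *
          sliceIntegrand Ψ s a (U.symm v).fst (U.symm w).fst (U.symm v).snd (U.symm w).snd y := by
    intro a y
    have h1 : inner ℝ x (U (WithLp.toLp 2 (a, y))) = ‖x‖ * a := by
      conv_lhs => rw [hx]
      rw [← hU, inner_smul_left, U.inner_map_map, WithLp.prod_inner_apply]
      simp [p]
    have h2 : ‖U (WithLp.toLp 2 (a, y))‖ = hypot a ‖y‖ := by
      rw [U.norm_map, WithLp.prod_norm_eq_of_L2]
      simp [hypot]
    simp only [kernelIntegrand, sliceIntegrand, radialPhase, h1, h2, hin]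
  have hmp : MeasurePreserving
      (fun q : ℝ × EuclideanSpace ℝ (Fin m) => U (WithLp.toLp 2 q)) :=
    U.measurePreserving.comp (WithLp.volume_preserving_toLp _ _)
  have hemb : MeasurableEmbedding
      (fun q : ℝ × EuclideanSpace ℝ (Fin m) => U (WithLp.toLp 2 q)) :=
    (U.toMeasurableEquiv.measurableEmbedding).comp
      (MeasurableEquiv.toLp 2 (ℝ × EuclideanSpace ℝ (Fin m))).measurableEmbedding
  have hint := (hmp.integrable_comp_emb hemb).2 (integrable_kernelIntegrand hΨ s x v w)
  rw [← hmp.integral_comp hemb, Measure.volume_eq_prod,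
    integral_prod (fun q => kernelIntegrand Ψ s x v w (U (WithLp.toLp 2 q))) hint]
  simp only [hcomp, integral_const_mul]
  refine (norm_integral_le_of_norm_le (g := (Set.Icc (-4 : ℝ) 4).indicator fun _ => C * δ ^ m)
    ?_ ?_).trans_eq ?_
  · rw [integrable_indicator_iff measurableSet_Icc]
    exact integrableOn_const (by simp)
  -- The height `a = 0`, where `hypot` is not smooth at `r = 0`, is a null set.
  · filter_upwards [compl_mem_ae_iff.2 (measure_singleton (0 : ℝ))] with a ha
    rw [norm_mul, mul_comm Complex.I, Complex.norm_exp_ofReal_mul_I, one_mul]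
    have := U.symm.norm_map v
    have := U.symm.norm_map w
    exact h a s δ _ _ _ _ ha hδ hδ1 hs ((hfst _).trans (by linarith)) ((hfst _).trans (by linarith))
      ((hsnd _).trans (by linarith)) ((hsnd _).trans (by linarith))
  · rw [integral_indicator measurableSet_Icc, setIntegral_const]
    norm_num
    ring

/-- The dispersive estimate for the kernel of the frequency-localized half-wave propagator. -/
theorem exists_norm_integral_kernelIntegrand_le {n : ℕ} (hn : 2 ≤ n) {Ψ : ℝ → ℝ}
    (hΨ : IsAnnularCutoff Ψ) :
    ∃ C : ℝ, 0 ≤ C ∧ ∀ (s : ℝ) (x v w : EuclideanSpace ℝ (Fin n)), s ≠ 0 → ‖v‖ ≤ 1 → ‖w‖ ≤ 1 →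
      ‖∫ ξ, kernelIntegrand Ψ s x v w ξ‖ ≤ C * |s| ^ (-(((n : ℝ) - 1) / 2)) := by
  obtain ⟨m, rfl⟩ : ∃ m, n = m + 1 := ⟨n - 1, by omega⟩
  obtain ⟨C, hC, h⟩ := exists_norm_integral_kernelIntegrand_le_pow (by omega : 1 ≤ m) hΨ
  obtain ⟨M, hM0, hM⟩ := hΨ.exists_bound
  set c := (volume : Measure (EuclideanSpace ℝ (Fin (m + 1)))).real (Metric.closedBall 0 4)
  have hc : 0 ≤ c := measureReal_nonneg
  refine ⟨C + c * (M * 4 * 4), by positivity, fun s x v w hs hv hw => ?_⟩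
  have hexp : -((((m + 1 : ℕ) : ℝ) - 1) / 2) = -((m : ℝ) / 2) := by push_cast; ring
  rw [hexp, add_mul]
  have hs0 : 0 < |s| := abs_pos.2 hs
  -- For `|s| ≥ 1` take `δ = |s|^{-1/2}`. For `|s| < 1` the power of `|s|` is at least 1, and the
  -- sup bound times the volume of the ball suffices.
  rcases le_or_gt 1 |s| with h1 | h1
  · have hδ : ((√|s|)⁻¹) ^ m = |s| ^ (-((m : ℝ) / 2)) := by
      rw [Real.sqrt_eq_rpow, ← Real.rpow_neg hs0.le, ← Real.rpow_natCast, ← Real.rpow_mul hs0.le]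
      congr 1
      ring
    rw [← hδ]
    refine (h s (√|s|)⁻¹ x v w (by positivity) (inv_le_one_of_one_le₀ (Real.one_le_sqrt.2 h1))
      ?_ hv hw).trans (le_add_of_nonneg_right (by positivity))
    rw [inv_pow, Real.sq_sqrt hs0.le, mul_inv_cancel₀ hs0.ne']
  · have hpow : 1 ≤ |s| ^ (-((m : ℝ) / 2)) :=
      Real.one_le_rpow_of_pos_of_le_one_of_nonpos hs0 h1.le (by
        have : (0 : ℝ) ≤ m := m.cast_nonneg
        linarith)
    have htriv : ‖∫ ξ, kernelIntegrand Ψ s x v w ξ‖ ≤ c * (M * 4 * 4) := by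
      refine (norm_integral_le_of_norm_le
        (g := (Metric.closedBall 0 4).indicator fun _ => M * 4 * 4) ?_
        (Filter.Eventually.of_forall fun ξ => ?_)).trans_eq ?_
      · rw [integrable_indicator_iff measurableSet_closedBall]
        exact integrableOn_const measure_closedBall_lt_top.ne
      · by_cases hξ : ξ ∈ Metric.closedBall (0 : EuclideanSpace ℝ (Fin (m + 1))) 4
        · have hξ4 : ‖ξ‖ ≤ 4 := by simpa using hξ
          have hi : ∀ z : EuclideanSpace ℝ (Fin (m + 1)), ‖z‖ ≤ 1 → |inner ℝ z ξ| ≤ 4 :=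
            fun z hz => (abs_real_inner_le_norm z ξ).trans
              ((mul_le_mul hz hξ4 (norm_nonneg _) zero_le_one).trans_eq (one_mul 4))
          rw [Set.indicator_of_mem hξ, kernelIntegrand, norm_mul, norm_mul, mul_comm Complex.I,
            mul_comm Complex.I, Complex.norm_exp_ofReal_mul_I, Complex.norm_exp_ofReal_mul_I,
            one_mul, one_mul, Complex.norm_real, Real.norm_eq_abs, abs_mul, abs_mul]
          gcongr
          · exact hM _
          · exact hi v hv
          · exact hi w hw
        · rw [kernelIntegrand_eq_zero hΨ s x v w (by simpa using hξ), norm_zero,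
            Set.indicator_of_notMem hξ]
      · rw [integral_indicator measurableSet_closedBall, setIntegral_const, smul_eq_mul]
    calc _ ≤ c * (M * 4 * 4) * 1 := by rw [mul_one]; exact htriv
      _ ≤ c * (M * 4 * 4) * |s| ^ (-((m : ℝ) / 2)) := by gcongr
      _ ≤ _ := le_add_of_nonneg_left (by positivity)

/-! ### Diagonalization of the matrix symbol -/

theorem Matrix.exp_smul_add_smul_one_sub {n : ℕ} {P : Matrix (Fin n) (Fin n) ℂ} (hP : P * P = P)
    (α β : ℂ) :
    NormedSpace.exp (α • (1 - P) + β • P)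
      = Complex.exp α • (1 - P) + Complex.exp β • P := by
  have hPQ : P * (1 - P) = 0 := by rw [mul_sub, hP, mul_one, sub_self]
  have hQP : (1 - P) * P = 0 := by rw [sub_mul, hP, one_mul, sub_self]
  have hQQ : (1 - P) * (1 - P) = 1 - P := by rw [mul_sub, hQP, mul_one, sub_zero]
  have hpow : ∀ k : ℕ, (α • (1 - P) + β • P) ^ k = α ^ k • (1 - P) + β ^ k • P := by
    intro k
    induction k with
    | zero => simp
    | succ k ih =>
      rw [pow_succ, ih]
      simp only [add_mul, mul_add, smul_mul_smul_comm, hPQ, hQP, hP, hQQ, smul_zero, pow_succ,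
        add_zero, zero_add]
  have hs : ∀ z : ℂ, HasSum (fun k : ℕ => (k.factorial : ℂ)⁻¹ * z ^ k) (Complex.exp z) := fun z => by
    simpa [Complex.exp_eq_exp_ℂ, smul_eq_mul] using NormedSpace.exp_series_hasSum_exp' (𝕂 := ℂ) z
  have h := ((hs α).smul_const (1 - P)).add ((hs β).smul_const P)
  rw [← h.tsum_eq]
  refine (congrFun (NormedSpace.exp_eq_tsum ℂ) _).trans (tsum_congr fun k => ?_)
  rw [hpow, smul_add, smul_smul, smul_smul]

/-- The matrix of the orthogonal projection onto the line spanned by `ξ`. -/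
def lineProjection {n : ℕ} (ξ : EuclideanSpace ℝ (Fin n)) : Matrix (Fin n) (Fin n) ℂ :=
  Matrix.of fun j k => ((ξ j * ξ k / ‖ξ‖ ^ 2 : ℝ) : ℂ)

section

variable {n : ℕ} {ξ : EuclideanSpace ℝ (Fin n)}

theorem lineProjection_mul_self (hξ : ξ ≠ 0) : lineProjection ξ * lineProjection ξ =
    lineProjection ξ := by
  have hn : ‖ξ‖ ^ 2 ≠ 0 := pow_ne_zero 2 (norm_ne_zero_iff.2 hξ)
  ext j k
  simp only [lineProjection, Matrix.mul_apply, Matrix.of_apply, ← Complex.ofReal_mul,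
    ← Complex.ofReal_sum]
  congr 1
  have : ∀ l, ξ j * ξ l / ‖ξ‖ ^ 2 * (ξ l * ξ k / ‖ξ‖ ^ 2)
      = ξ j * ξ k / (‖ξ‖ ^ 2 * ‖ξ‖ ^ 2) * ξ l ^ 2 := fun l => by field_simp
  simp only [this, ← Finset.mul_sum, ← EuclideanSpace.real_norm_sq_eq]
  field_simp

theorem Matrix.posSemidef_of_isHermitian_of_mul_self {P : Matrix (Fin n) (Fin n) ℂ}
    (hP : P.IsHermitian) (hPP : P * P = P) : P.PosSemidef := by
  have h := Matrix.posSemidef_conjTranspose_mul_self P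
  rwa [hP.eq, hPP] at h

theorem isHermitian_lineProjection : (lineProjection ξ).IsHermitian := by
  ext j k
  simp only [lineProjection, Matrix.conjTranspose_apply, Matrix.of_apply, RCLike.star_def,
    Complex.conj_ofReal, mul_comm (ξ k)]

/-- `L(ξ)` has eigenvalue `(λ+2μ)|ξ|²` along `ξ` and `μ|ξ|²` across it. The right side is positive
semidefinite and squares to `L(ξ)`, so uniqueness of the root applies. -/
theorem sqrt_lameSymbol {lam mu : ℝ} (hmu : 0 < mu) (hlam : 0 < lam + 2 * mu) (hξ : ξ ≠ 0) :
    CFC.sqrt (lameSymbol lam mu ξ) = ((√mu * ‖ξ‖ : ℝ) : ℂ) • (1 - lineProjection ξ)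
      + ((√(lam + 2 * mu) * ‖ξ‖ : ℝ) : ℂ) • lineProjection ξ := by
  have hP := lineProjection_mul_self hξ
  have hn : ‖ξ‖ ^ 2 ≠ 0 := pow_ne_zero 2 (norm_ne_zero_iff.2 hξ)
  have hPQ : lineProjection ξ * (1 - lineProjection ξ) = 0 := by
    rw [mul_sub, hP, mul_one, sub_self]
  have hQP : (1 - lineProjection ξ) * lineProjection ξ = 0 := by
    rw [sub_mul, hP, one_mul, sub_self]
  have hQQ : (1 - lineProjection ξ) * (1 - lineProjection ξ) = 1 - lineProjection ξ := by
    rw [mul_sub, hQP, mul_one, sub_zero]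
  refine CFC.sqrt_unique ?_ ?_
  · simp only [add_mul, mul_add, smul_mul_smul_comm, hPQ, hQP, hP, hQQ, smul_zero, add_zero,
      zero_add, ← Complex.ofReal_mul]
    rw [show √mu * ‖ξ‖ * (√mu * ‖ξ‖) = mu * ‖ξ‖ ^ 2 by
        linear_combination ‖ξ‖ ^ 2 * Real.mul_self_sqrt hmu.le,
      show √(lam + 2 * mu) * ‖ξ‖ * (√(lam + 2 * mu) * ‖ξ‖) = (lam + 2 * mu) * ‖ξ‖ ^ 2 by
        linear_combination ‖ξ‖ ^ 2 * Real.mul_self_sqrt hlam.le]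
    have hPn : ((‖ξ‖ ^ 2 : ℝ) : ℂ) • lineProjection ξ
        = Matrix.of fun j k => ((ξ j * ξ k : ℝ) : ℂ) := by
      ext j k
      simp only [lineProjection, Matrix.smul_apply, Matrix.of_apply, smul_eq_mul,
        ← Complex.ofReal_mul]
      rw [mul_div_cancel₀ _ hn]
    rw [lameSymbol, ← hPn]
    module
  · rw [Matrix.nonneg_iff_posSemidef]
    refine ((Matrix.posSemidef_of_isHermitian_of_mul_self
      (Matrix.isHermitian_one.sub isHermitian_lineProjection) hQQ).smul ?_).add
      ((Matrix.posSemidef_of_isHermitian_of_mul_self isHermitian_lineProjection hP).smul ?_)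
    · exact_mod_cast (by positivity : 0 ≤ √mu * ‖ξ‖)
    · exact_mod_cast (by positivity : 0 ≤ √(lam + 2 * mu) * ‖ξ‖)

theorem halfWaveSymbol_eq {lam mu : ℝ} (hmu : 0 < mu) (hlam : 0 < lam + 2 * mu) (hξ : ξ ≠ 0)
    (t : ℝ) : halfWaveSymbol lam mu t ξ =
      Complex.exp (Complex.I * ((√mu * t * ‖ξ‖ : ℝ) : ℂ)) • (1 - lineProjection ξ)
        + Complex.exp (Complex.I * ((√(lam + 2 * mu) * t * ‖ξ‖ : ℝ) : ℂ)) • lineProjection ξ := by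
  rw [halfWaveSymbol, sqrt_lameSymbol hmu hlam hξ, smul_add, smul_smul, smul_smul,
    Matrix.exp_smul_add_smul_one_sub (lineProjection_mul_self hξ)]
  congr 3 <;> (push_cast; ring)

end

/-! ### From kernel bounds to the propagator -/

/-- A smooth function supported in `[1/4, 4]` that equals `u⁻²` on `[1/2, 2]`. -/
theorem exists_isAnnularCutoff_eq_inv_sq :
    ∃ Ψ : ℝ → ℝ, IsAnnularCutoff Ψ ∧ ∀ u, 1 / 2 ≤ u → u ≤ 2 → Ψ u = (u ^ 2)⁻¹ := by
  -- Centre `5/4` with radii `3/4` and `1`: equal to 1 on `[1/2, 2]`, zero outside `(1/4, 9/4)`.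
  let χ : ContDiffBump (5 / 4 : ℝ) := ⟨3 / 4, 1, by norm_num, by norm_num⟩
  have hzero : ∀ u, u ∉ Set.Ioo (1 / 4 : ℝ) (9 / 4) → χ u = 0 := by
    intro u hu
    refine χ.zero_of_le_dist ?_
    rw [Real.dist_eq, le_abs]
    by_contra! h
    exact hu ⟨by linarith [h.2], by linarith [h.1]⟩
  refine ⟨fun u => χ u * (u ^ 2)⁻¹, ⟨?_, fun u hu => ?_⟩, fun u h1 h2 => ?_⟩
  · refine contDiff_iff_contDiffAt.2 fun u => ?_
    rcases eq_or_ne u 0 with rfl | hu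
    · refine (contDiffAt_const (c := (0 : ℝ))).congr_of_eventuallyEq ?_
      filter_upwards [Iio_mem_nhds (show (0 : ℝ) < 1 / 4 by norm_num)] with v hv
      rw [hzero v fun h => not_lt.2 h.1.le hv, zero_mul]
    · exact χ.contDiffAt.mul ((contDiffAt_id.pow 2).inv (pow_ne_zero 2 hu))
  · rw [hzero u fun h => hu ⟨h.1.le, by linarith [h.2]⟩, zero_mul]
  · have hχ : χ u = 1 := by
      refine χ.one_of_mem_closedBall ?_
      rw [Metric.mem_closedBall, Real.dist_eq, abs_le]
      constructor <;> linarith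
    simp only [hχ, one_mul]

section Multiplier

variable {n : ℕ} {A h : EuclideanSpace ℝ (Fin n) → ℂ}

theorem integrable_symbol_mul_phase_mul (hA : Integrable A) (hh : Integrable h)
    (x : EuclideanSpace ℝ (Fin n)) :
    Integrable (fun p : EuclideanSpace ℝ (Fin n) × EuclideanSpace ℝ (Fin n) =>
      Complex.exp (Complex.I * (inner ℝ x p.1 : ℝ)) *
        (A p.1 * (Complex.exp (-Complex.I * (inner ℝ p.2 p.1 : ℝ)) * h p.2)))
      (volume.prod volume) := by
  have hb : ∀ p : EuclideanSpace ℝ (Fin n) × EuclideanSpace ℝ (Fin n),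
      ‖Complex.exp (Complex.I * (inner ℝ x p.1 : ℝ)) *
        Complex.exp (-Complex.I * (inner ℝ p.2 p.1 : ℝ))‖ ≤ 1 := by
    intro p
    rw [← Complex.exp_add, show Complex.I * (inner ℝ x p.1 : ℝ) + -Complex.I * (inner ℝ p.2 p.1 : ℝ)
      = ((inner ℝ x p.1 - inner ℝ p.2 p.1 : ℝ) : ℂ) * Complex.I by push_cast; ring,
      Complex.norm_exp_ofReal_mul_I]
  have hc : Continuous fun p : EuclideanSpace ℝ (Fin n) × EuclideanSpace ℝ (Fin n) =>
      Complex.exp (Complex.I * (inner ℝ x p.1 : ℝ)) *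
        Complex.exp (-Complex.I * (inner ℝ p.2 p.1 : ℝ)) := by fun_prop
  refine ((hA.mul_prod hh).bdd_mul hc.aestronglyMeasurable (Filter.Eventually.of_forall hb)).congr
    (Filter.Eventually.of_forall fun p => ?_)
  simp only
  ring

theorem integrable_symbol_mul_fourier (hA : Integrable A) (hh : Integrable h) :
    Integrable fun ξ => A ξ * ∫ y, Complex.exp (-Complex.I * (inner ℝ y ξ : ℝ)) * h y := by
  have := (integrable_symbol_mul_phase_mul hA hh 0).integral_prod_left
  simpa [integral_const_mul] using this

/-- By Fubini the operator is convolution with the inverse transform of `A`, and a bounded kernel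
maps `L¹` to `L^∞`. -/
theorem norm_integral_symbol_mul_fourier_le (hA : Integrable A) (hh : Integrable h) {B : ℝ}
    (hB : ∀ z, ‖∫ ξ, Complex.exp (Complex.I * (inner ℝ z ξ : ℝ)) * A ξ‖ ≤ B)
    (x : EuclideanSpace ℝ (Fin n)) :
    ‖∫ ξ, Complex.exp (Complex.I * (inner ℝ x ξ : ℝ)) *
      (A ξ * ∫ y, Complex.exp (-Complex.I * (inner ℝ y ξ : ℝ)) * h y)‖ ≤ B * ∫ y, ‖h y‖ := by
  simp only [← integral_const_mul]
  rw [integral_integral_swap (integrable_symbol_mul_phase_mul hA hh x)]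
  refine norm_integral_le_of_norm_le (hh.norm.const_mul B) (Filter.Eventually.of_forall fun y => ?_)
  have : (∫ ξ, Complex.exp (Complex.I * (inner ℝ x ξ : ℝ)) *
      (A ξ * (Complex.exp (-Complex.I * (inner ℝ y ξ : ℝ)) * h y)))
      = (∫ ξ, Complex.exp (Complex.I * (inner ℝ (x - y) ξ : ℝ)) * A ξ) * h y := by
    rw [← integral_mul_const]
    congr 1
    funext ξ
    rw [inner_sub_left, show Complex.I * ((inner ℝ x ξ - inner ℝ y ξ : ℝ) : ℂ)
      = Complex.I * (inner ℝ x ξ : ℝ) + -Complex.I * (inner ℝ y ξ : ℝ) by push_cast; ring,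
      Complex.exp_add]
    ring
  rw [this, norm_mul]
  gcongr
  exact hB _

end Multiplier

/-- The entries of the half-wave symbol, with `‖ξ‖⁻²` replaced by `Ψ ‖ξ‖`; `s₁` and `s₂` are the
times scaled by the shear and pressure speeds. -/
def localizedEntry {n : ℕ} (Ψ : ℝ → ℝ) (s₁ s₂ : ℝ) (j k : Fin n) (ξ : EuclideanSpace ℝ (Fin n)) :
    ℂ :=
  (if j = k then
      ∑ l, kernelIntegrand Ψ s₁ 0 (EuclideanSpace.single l 1) (EuclideanSpace.single l 1) ξ else 0)
    - kernelIntegrand Ψ s₁ 0 (EuclideanSpace.single j 1) (EuclideanSpace.single k 1) ξ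
    + kernelIntegrand Ψ s₂ 0 (EuclideanSpace.single j 1) (EuclideanSpace.single k 1) ξ

section

variable {n : ℕ} {Ψ : ℝ → ℝ}

theorem integrable_localizedEntry (hΨ : IsAnnularCutoff Ψ) (s₁ s₂ : ℝ) (j k : Fin n) :
    Integrable (localizedEntry Ψ s₁ s₂ j k) := by
  have h := fun s v w => integrable_kernelIntegrand (n := n) hΨ s 0 v w
  unfold localizedEntry
  refine (Integrable.sub ?_ (h _ _ _)).add (h _ _ _)
  split_ifs
  · exact integrable_finsetSum _ fun l _ => h _ _ _
  · exact integrable_zero _ _ _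

theorem exp_mul_kernelIntegrand_zero (s : ℝ) (x v w ξ : EuclideanSpace ℝ (Fin n)) :
    Complex.exp (Complex.I * (inner ℝ x ξ : ℝ)) * kernelIntegrand Ψ s 0 v w ξ
      = kernelIntegrand Ψ s x v w ξ := by
  simp [kernelIntegrand]

theorem norm_integral_exp_mul_localizedEntry_le (hΨ : IsAnnularCutoff Ψ) {s₁ s₂ B₁ B₂ : ℝ}
    (h₁ : ∀ x v w : EuclideanSpace ℝ (Fin n), ‖v‖ ≤ 1 → ‖w‖ ≤ 1 →
      ‖∫ ξ, kernelIntegrand Ψ s₁ x v w ξ‖ ≤ B₁)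
    (h₂ : ∀ x v w : EuclideanSpace ℝ (Fin n), ‖v‖ ≤ 1 → ‖w‖ ≤ 1 →
      ‖∫ ξ, kernelIntegrand Ψ s₂ x v w ξ‖ ≤ B₂) (j k : Fin n) (x : EuclideanSpace ℝ (Fin n)) :
    ‖∫ ξ, Complex.exp (Complex.I * (inner ℝ x ξ : ℝ)) * localizedEntry Ψ s₁ s₂ j k ξ‖
      ≤ n * B₁ + B₁ + B₂ := by
  have hi := fun s v w => integrable_kernelIntegrand (n := n) hΨ s x v w
  have hB₁ : 0 ≤ B₁ := (norm_nonneg _).trans (h₁ 0 0 0 (by simp) (by simp))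
  have he : ∀ l : Fin n, ‖EuclideanSpace.single l (1 : ℝ)‖ ≤ 1 := fun l => by simp
  have hd : Integrable fun ξ => if j = k then
      ∑ l, kernelIntegrand Ψ s₁ x (EuclideanSpace.single l 1) (EuclideanSpace.single l 1) ξ
      else 0 := by
    split_ifs
    · exact integrable_finsetSum _ fun l _ => hi _ _ _
    · exact integrable_zero _ _ _
  have hsub : Integrable fun ξ => (if j = k then
      ∑ l, kernelIntegrand Ψ s₁ x (EuclideanSpace.single l 1) (EuclideanSpace.single l 1) ξ
      else 0) - kernelIntegrand Ψ s₁ x (EuclideanSpace.single j 1) (EuclideanSpace.single k 1) ξ :=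
    hd.sub (hi _ _ _)
  simp only [localizedEntry, mul_add, mul_sub, mul_ite, mul_zero, Finset.mul_sum,
    exp_mul_kernelIntegrand_zero]
  rw [integral_add hsub (hi _ _ _), integral_sub hd (hi _ _ _)]
  refine (norm_add_le _ _).trans (add_le_add ((norm_sub_le _ _).trans (add_le_add ?_ ?_)) ?_)
  · split_ifs
    · rw [integral_finsetSum _ fun l _ => hi _ _ _]
      refine (norm_sum_le_of_le _ fun l _ => h₁ _ _ _ (he l) (he l)).trans_eq ?_
      simp
    · simp only [integral_zero, norm_zero]
      positivity
  · exact h₁ _ _ _ (he j) (he k)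
  · exact h₂ _ _ _ (he j) (he k)

/-- Where `Ψ(|ξ|)|ξ|² = 1`, the diagonal sum of `Ψ ξ_l²` reproduces the identity matrix, so the `1`
in `1 - P` is also of kernel form. -/
theorem halfWaveSymbol_apply_eq_localizedEntry {lam mu : ℝ} (hmu : 0 < mu)
    (hlam : 0 < lam + 2 * mu) {ξ : EuclideanSpace ℝ (Fin n)} (hξ : ξ ≠ 0)
    (hΨ : Ψ ‖ξ‖ = (‖ξ‖ ^ 2)⁻¹) (t : ℝ) (j k : Fin n) :
    halfWaveSymbol lam mu t ξ j k
      = localizedEntry Ψ (√mu * t) (√(lam + 2 * mu) * t) j k ξ := by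
  have hn : ((‖ξ‖ ^ 2 : ℝ) : ℂ) ≠ 0 :=
    Complex.ofReal_ne_zero.2 (pow_ne_zero 2 (norm_ne_zero_iff.2 hξ))
  have hsum : ∑ l, (ξ l : ℂ) * ξ l = ((‖ξ‖ ^ 2 : ℝ) : ℂ) := by
    rw [EuclideanSpace.real_norm_sq_eq]
    push_cast
    simp [sq]
  have hker : ∀ (s : ℝ) (p q : Fin n),
      kernelIntegrand Ψ s 0 (EuclideanSpace.single p 1) (EuclideanSpace.single q 1) ξ
        = Complex.exp (Complex.I * ((s * ‖ξ‖ : ℝ) : ℂ)) * (((‖ξ‖ ^ 2 : ℝ) : ℂ)⁻¹ *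
          ((ξ p : ℂ) * ξ q)) := by
    intro s p q
    simp only [kernelIntegrand, inner_zero_left, EuclideanSpace.inner_single_left, hΨ]
    simp [mul_assoc]
  rw [halfWaveSymbol_eq hmu hlam hξ, localizedEntry]
  simp only [hker, ← Finset.mul_sum, hsum, inv_mul_cancel₀ hn]
  simp only [Matrix.add_apply, Matrix.smul_apply, Matrix.sub_apply, Matrix.one_apply,
    lineProjection, Matrix.of_apply, smul_eq_mul]
  push_cast
  split_ifs <;> ring

theorem mulVec_angularFourier_eq {lam mu : ℝ} (hmu : 0 < mu) (hlam : 0 < lam + 2 * mu)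
    (hΨ : ∀ u, 1 / 2 ≤ u → u ≤ 2 → Ψ u = (u ^ 2)⁻¹) {f : VectorField n}
    (hf : Function.support (angularFourier f) ⊆ {ξ | 1 / 2 ≤ ‖ξ‖ ∧ ‖ξ‖ ≤ 2}) (t : ℝ)
    (ξ : EuclideanSpace ℝ (Fin n)) (j : Fin n) :
    (halfWaveSymbol lam mu t ξ).mulVec (angularFourier f ξ) j
      = ∑ k, localizedEntry Ψ (√mu * t) (√(lam + 2 * mu) * t) j k ξ * angularFourier f ξ k := by
  by_cases h : angularFourier f ξ = 0
  · simp [h]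
  · obtain ⟨h1, h2⟩ := hf h
    have hξ : ξ ≠ 0 := by
      rintro rfl
      norm_num at h1
    simp only [Matrix.mulVec, dotProduct,
      halfWaveSymbol_apply_eq_localizedEntry hmu hlam hξ (hΨ _ h1 h2)]

end

theorem vectorLpNorm_one_eq {n : ℕ} {f : VectorField n} (hf : Integrable f volume) :
    vectorLpNorm f 1 = ENNReal.ofReal (∑ k, ∫ y, ‖f y k‖) := by
  rw [vectorLpNorm, if_neg ENNReal.one_ne_top,
    ENNReal.ofReal_sum_of_nonneg fun k _ => integral_nonneg fun y => norm_nonneg _]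
  simp only [ENNReal.toReal_one, ENNReal.rpow_one, div_one]
  refine Finset.sum_congr rfl fun k _ => ?_
  rw [eLpNorm_one_eq_lintegral_enorm, ofReal_integral_norm_eq_lintegral_enorm (hf.eval k)]

theorem theoremt (n : ℕ) (hn : 2 ≤ n) (lam mu : ℝ) (hmu : 0 < mu) (hlam : 0 < lam + 2 * mu) :
    ∃ C : ℝ, 0 < C ∧ ∀ f : VectorField n, Integrable f volume →
      Function.support (angularFourier f) ⊆ {ξ | 1 / 2 ≤ ‖ξ‖ ∧ ‖ξ‖ ≤ 2} →
      ∀ t : ℝ, t ≠ 0 →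
        Integrable (fun ξ => (halfWaveSymbol lam mu t ξ).mulVec (angularFourier f ξ)) volume ∧
        vectorLpNorm (elasticHalfWave lam mu t f) ∞ ≤
          ENNReal.ofReal (C * |t| ^ (-(((n : ℝ) - 1) / 2))) * vectorLpNorm f 1 := by
  obtain ⟨Ψ, hΨ, hΨeq⟩ := exists_isAnnularCutoff_eq_inv_sq
  obtain ⟨C, hC, hK⟩ := exists_norm_integral_kernelIntegrand_le hn hΨ
  set p : ℝ := -(((n : ℝ) - 1) / 2)
  have hs₁ : 0 < √mu := Real.sqrt_pos.2 hmu
  have hs₂ : 0 < √(lam + 2 * mu) := Real.sqrt_pos.2 hlam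
  -- The wave speeds are scaled out of `|ct|^p`. The shear speed counts `n + 1` times, for the
  -- diagonal sum and `P`; the pressure speed counts once. The final constant is `D + 1`, for strict
  -- positivity.
  set D : ℝ := n * (C * √mu ^ p) + C * √mu ^ p + C * √(lam + 2 * mu) ^ p
  have hD : 0 ≤ D := by positivity
  refine ⟨D + 1, by positivity, fun f hf hsupp t ht => ?_⟩
  have hentry := fun j k => integrable_localizedEntry (n := n) hΨ (√mu * t)
    (√(lam + 2 * mu) * t) j k
  have hsymb := mulVec_angularFourier_eq hmu hlam hΨeq hsupp t
  have hterm := fun j k => integrable_symbol_mul_fourier (hentry j k) (hf.eval k)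
  have hscale : ∀ c : ℝ, 0 < c → ∀ x v w : EuclideanSpace ℝ (Fin n), ‖v‖ ≤ 1 → ‖w‖ ≤ 1 →
      ‖∫ ξ, kernelIntegrand Ψ (c * t) x v w ξ‖ ≤ C * c ^ p * |t| ^ p := by
    intro c hc x v w hv hw
    refine (hK (c * t) x v w (mul_ne_zero hc.ne' ht) hv hw).trans_eq ?_
    rw [abs_mul, abs_of_pos hc, Real.mul_rpow hc.le (abs_nonneg t), mul_assoc]
  refine ⟨Integrable.of_eval fun j => ?_, ?_⟩
  · simp only [hsymb]
    exact integrable_finsetSum _ fun k _ => hterm j k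
  have hbound : ∀ j x, ‖elasticHalfWave lam mu t f x j‖
      ≤ (D + 1) * |t| ^ p * ∑ k, ∫ y, ‖f y k‖ := by
    intro j x
    have hpi : ‖((2 * Real.pi : ℝ) : ℂ)⁻¹ ^ n‖ ≤ 1 := by
      rw [norm_pow, norm_inv, Complex.norm_real, Real.norm_of_nonneg (by positivity)]
      exact pow_le_one₀ (by positivity)
        (inv_le_one_of_one_le₀ (by linarith [Real.pi_gt_three]))
    have hterm' : ∀ k, Integrable fun ξ => Complex.exp (Complex.I * (inner ℝ x ξ : ℝ)) *
        (localizedEntry Ψ (√mu * t) (√(lam + 2 * mu) * t) j k ξ * angularFourier f ξ k) := by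
      intro k
      have hc : Continuous fun ξ : EuclideanSpace ℝ (Fin n) =>
        Complex.exp (Complex.I * (inner ℝ x ξ : ℝ)) := by fun_prop
      refine (hterm j k).bdd_mul (c := 1) hc.aestronglyMeasurable
        (Filter.Eventually.of_forall fun ξ => ?_)
      rw [mul_comm, Complex.norm_exp_ofReal_mul_I]
    simp only [elasticHalfWave, matrixMultiplier, angularFourierInv, hsymb, Finset.mul_sum]
    rw [integral_finsetSum _ fun k _ => hterm' k, norm_mul]
    refine (mul_le_mul_of_nonneg_right hpi (norm_nonneg _)).trans ?_
    rw [one_mul]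
    refine norm_sum_le_of_le _ fun k _ => ?_
    refine (norm_integral_symbol_mul_fourier_le (hentry j k) (hf.eval k)
      (norm_integral_exp_mul_localizedEntry_le hΨ (hscale _ hs₁) (hscale _ hs₂) j k) x).trans ?_
    gcongr
    calc _ = D * |t| ^ p := by simp only [D]; ring
      _ ≤ (D + 1) * |t| ^ p := by gcongr; linarith
  rw [vectorLpNorm_one_eq hf, ← ENNReal.ofReal_mul (by positivity), vectorLpNorm, if_pos rfl]
  refine iSup_le fun j => ?_
  rw [eLpNorm_exponent_top]
  exact eLpNormEssSup_le_of_ae_bound (Filter.Eventually.of_forall (hbound j))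

end
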